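/- A digraph $Q$ is a finite vertex set in which each pair of distinct vertices is joined by at most one connection (and no vertex is joined to itself); a connection is either a non-oriented edge $i - j$ or an arrow $i \to j$. The Hecke--Kiselman monoid $H_Q$ is the monoid generated by elements $a_i$, indexed by the vertices $i$ of $Q$, with the relations - $a_i^2 = a_i$ for every vertex $i$; - $a_i a_j = a_j a_i$ if $i$ and $j$ are not connected; - $a_i a_j a_i = a_j a_i a_j$ if $i$ and $j$ are connected by an edge; - $a_i a_j = a_i a_j a_i = a_j a_i a_j$ if there is an arrow $i \to j$. $Q$ is of finite type if $H_Q$ is finite, and of infinite type otherwise. A cycle in $Q$ is a sequence of distinct vertices $(v_i)_{i \in \mathbb{Z}/n\mathbb{Z}}$, $n \ge 3$, such that for each $i$ there is an edge between $v_i$ and $v_{i+1}$ or an arrow $v_i \to v_{i+1}$; $Q$ is acyclic if it contains no cycle. Let $K$ be the digraph with vertices $a, b, c, d$, edges $a - b$ and $c - d$, and arrows $a \to c$, $a \to d$, $b \to c$, $b \to d$. **Theorem.** $K$ is, up to isomorphism, the only acyclic digraph of infinite type with four vertices. That is, $K$ is acyclic and $H_K$ is infinite, and every acyclic digraph $Q$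 with four vertices such that $H_Q$ is infinite is isomorphic to $K$. Moreover, a digraph $Q$ with at most four vertices is of finite type if and only if it is acyclic and not isomorphic to $K$. -/

import Mathlib

/-- A digraph with at most one connection (side) between each pair of distinct vertices; a side is
either a non-oriented edge or an arrow. (No loops: `edge` is irreflexive as a `SimpleGraph`, and
`arrow` is irreflexive by `arrow_asymm`.) -/
structure MixedDigraph (V : Type*) where
  /-- the non-oriented sides -/
  edge : SimpleGraph V
  /-- `arrow i j` : there is an arrow from `i` to `j` -/
  arrow : V → V → Prop
  arrow_asymm : ∀ i j, arrow i j → ¬ arrow j i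
  not_edge_of_arrow : ∀ i j, arrow i j → ¬ edge.Adj i j

namespace MixedDigraph

/-- `i` and `j` are joined by an edge or by an arrow (in either direction). -/
def Connected {V : Type*} (Q : MixedDigraph V) (i j : V) : Prop :=
  Q.edge.Adj i j ∨ Q.arrow i j ∨ Q.arrow j i

/-- The defining relations of the Hecke-Kiselman monoid. -/
inductive HKRel {V : Type*} (Q : MixedDigraph V) : FreeMonoid V → FreeMonoid V → Prop
  | idem (i : V) :
      HKRel Q (FreeMonoid.of i * FreeMonoid.of i) (FreeMonoid.of i)
  | comm (i j : V) (h : ¬ Q.Connected i j) :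
      HKRel Q (FreeMonoid.of i * FreeMonoid.of j) (FreeMonoid.of j * FreeMonoid.of i)
  | braid (i j : V) (h : Q.edge.Adj i j) :
      HKRel Q (FreeMonoid.of i * FreeMonoid.of j * FreeMonoid.of i)
        (FreeMonoid.of j * FreeMonoid.of i * FreeMonoid.of j)
  | arrow_left (i j : V) (h : Q.arrow i j) :
      HKRel Q (FreeMonoid.of i * FreeMonoid.of j)
        (FreeMonoid.of i * FreeMonoid.of j * FreeMonoid.of i)
  | arrow_right (i j : V) (h : Q.arrow i j) :
      HKRel Q (FreeMonoid.of i * FreeMonoid.of j)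
        (FreeMonoid.of j * FreeMonoid.of i * FreeMonoid.of j)

/-- The Hecke-Kiselman monoid `H_Q`. -/
abbrev HeckeKiselman {V : Type*} (Q : MixedDigraph V) : Type _ :=
  PresentedMonoid Q.HKRel

/-- `Q` is of finite type when its Hecke-Kiselman monoid is finite. -/
def FiniteType {V : Type*} (Q : MixedDigraph V) : Prop :=
  Finite Q.HeckeKiselman

/-- A cycle of length `n`: distinct vertices indexed by `ℤ/nℤ`, `n ≥ 3`, such that there is an edge
or an arrow going from each one to the next. -/
def IsCycle {V : Type*} (Q : MixedDigraph V) (n : ℕ) (c : ZMod n → V) : Prop :=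
  3 ≤ n ∧ Function.Injective c ∧
    ∀ i, Q.edge.Adj (c i) (c (i + 1)) ∨ Q.arrow (c i) (c (i + 1))

/-- `Q` contains no cycle. -/
def Acyclic {V : Type*} (Q : MixedDigraph V) : Prop :=
  ∀ (n : ℕ) (c : ZMod n → V), ¬ Q.IsCycle n c

/-- Two digraphs are isomorphic: some bijection of the vertices preserves and reflects edges and
arrows. -/
def Isomorphic {V W : Type*} (Q : MixedDigraph V) (R : MixedDigraph W) : Prop :=
  ∃ e : V ≃ W, (∀ i j, R.edge.Adj (e i) (e j) ↔ Q.edge.Adj i j) ∧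
    ∀ i j, R.arrow (e i) (e j) ↔ Q.arrow i j

/-- The digraph `K` on the vertices `a, b, c, d = 0, 1, 2, 3`: the edges are `a - b` and `c - d`,
the arrows are `a → c`, `a → d`, `b → c`, `b → d`. -/
def K : MixedDigraph (Fin 4) where
  edge := SimpleGraph.fromEdgeSet {s(0, 1), s(2, 3)}
  arrow i j := (i = 0 ∨ i = 1) ∧ (j = 2 ∨ j = 3)
  arrow_asymm := by decide
  not_edge_of_arrow := by
    intro i j h
    simp only [SimpleGraph.fromEdgeSet_adj, Set.mem_insert_iff, Set.mem_singleton_iff]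
    revert i j
    decide

end MixedDigraph

/-! Record a digraph by the relation `Step`, where an edge counts in both directions. For distinct
vertices, the defining relations then say: the generators are idempotent, every pair satisfies `xyx
= yxy`, and `xyx = xy` whenever there is no step from `y` to `x`. Adding steps only discards
relations, so finiteness passes to subrelations (`FiniteRep.comap`).

Infinite types: a cycle acts on `ZMod n → ℕ` by replacing a coordinate by one plus the next, which
makes values unbounded (`not_finiteRep_cycle`); `K` acts on a finite automaton with a counter
(`not_finiteRep_kRel`).

Finite types: reversing all steps gives the opposite monoid, and removing a sink preserves
infiniteness since a sink need occur only once in a word (`FiniteRep.of_sink`). A check of all 4096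
relations on four vertices finds a cycle, or `K`, or a relation that becomes, after removing sinks
and sources, part of a path of edges, a star of edges, or `K` minus an arrow. These three are finite
by rewriting (`finiteRep_of_completion`): only soundness and termination of the rules matter, not
confluence. -/

namespace MixedDigraph

/-! ### Verified completion of rewriting systems -/

namespace Rewriting

variable {n : ℕ}

/-- A rewriting rule `(l, r)` replaces the word `l` by the word `r`. -/
abbrev Rules (n : ℕ) := List (List (Fin n) × List (Fin n))

/-- Apply the first applicable rule at the beginning of a word. -/
def headStep (R : Rules n) (w : List (Fin n)) : Option (List (Fin n)) :=
  R.findSome? fun p => if p.1.isPrefixOf w then some (p.2 ++ w.drop p.1.length) else none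

/-- Reduce a word, starting from its end, as long as `fuel` permits. -/
def normalize (R : Rules n) : ℕ → List (Fin n) → List (Fin n)
  | 0, w => w
  | _ + 1, [] => []
  | fuel + 1, x :: w =>
    match headStep R (x :: normalize R fuel w) with
    | none => x :: normalize R fuel w
    | some v => normalize R fuel v

/-- The weight by which rules are oriented. -/
def weight : List (Fin n) → ℕ
  | [] => 0
  | x :: w => (x + 1) * (n + 1) ^ w.length + weight w

/-- Reduce `w` in two ways, at its beginning first or at its end first, and add the resulting
equation to the rules. -/
def superpose (R : Rules n) (w : List (Fin n)) : Rules n :=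
  let u := normalize R 50 ((headStep R w).getD w)
  let v := normalize R 50 w
  if weight u < weight v then R ++ [(v, u)] else R ++ [(u, v)]

/-- The defining relations of the Hecke-Kiselman monoid attached to `r`, as rules. -/
def baseRules (r : Fin n → Fin n → Bool) : Rules n :=
  (List.finRange n).flatMap fun i => (List.finRange n).flatMap fun j =>
    if i = j then [([i, i], [i])]
    else if r i j then
      if r j i then [([i, j, i], [j, i, j])] else [([i, j, i], [i, j]), ([j, i, j], [i, j])]
    else if r j i then [] else [([i, j], [j, i])]

/-- The rule decreases the weight of a word and does not increase its length. -/
def decreasing (p : List (Fin n) × List (Fin n)) : Bool :=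
  decide (p.2.length ≤ p.1.length) && decide (weight p.2 < weight p.1)

/-- Complete the relations attached to `r` by superposing at the words in `peaks`. -/
def completion (r : Fin n → Fin n → Bool) (peaks : List (List (Fin n))) : Rules n :=
  peaks.foldl superpose ((baseRules r).filter decreasing)

/-- The words of a given length to which no rule applies. -/
def irreducibles (R : Rules n) : ℕ → List (List (Fin n))
  | 0 => [[]]
  | k + 1 => (irreducibles R k).flatMap fun w =>
      ((List.finRange n).map (· :: w)).filter fun v => (headStep R v).isNone

end Rewriting

/-- A family of elements of a monoid satisfying the relations of the Hecke-Kiselman monoid of the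
digraph whose edges and arrows are recorded by the relation `r`: there is an edge between `i` and
`j` if both `r i j` and `r j i`, and an arrow from `i` to `j` if only `r i j`. -/
structure IsRep {V M : Type*} [Monoid M] (r : V → V → Prop) (φ : V → M) : Prop where
  idem : ∀ i, φ i * φ i = φ i
  braid : ∀ i j, φ i * φ j * φ i = φ j * φ i * φ j
  arrow : ∀ i j, ¬ r j i → φ i * φ j * φ i = φ i * φ j

/-- Every family satisfying the relations attached to `r` generates a finite monoid. -/
def FiniteRep.{v, u} {V : Type u} (r : V → V → Prop) : Prop :=
  ∀ (M : Type v) [Monoid M] (φ : V → M), IsRep r φ →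
    (Submonoid.closure (Set.range φ) : Set M).Finite

/-! ### Soundness and termination of the rewriting rules -/

namespace Rewriting

variable {n : ℕ} {M : Type*} [Monoid M] {φ : Fin n → M} {R : Rules n}

/-- The value of a word in a monoid. -/
def eval (φ : Fin n → M) (w : List (Fin n)) : M := (w.map φ).prod

theorem eval_append (u v : List (Fin n)) : eval φ (u ++ v) = eval φ u * eval φ v := by
  simp [eval]

theorem eval_cons (x : Fin n) (v : List (Fin n)) : eval φ (x :: v) = φ x * eval φ v := by
  simp [eval]

/-- All rules hold in the monoid. -/
def Sound (φ : Fin n → M) (R : Rules n) : Prop := ∀ p ∈ R, eval φ p.1 = eval φ p.2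

theorem headStep_spec {w v : List (Fin n)} (h : headStep R w = some v) :
    ∃ p ∈ R, ∃ s, w = p.1 ++ s ∧ v = p.2 ++ s := by
  obtain ⟨p, hp, hv⟩ := List.exists_of_findSome?_eq_some h
  split_ifs at hv with hpre
  obtain ⟨s, rfl⟩ := List.isPrefixOf_iff_prefix.1 hpre
  exact ⟨p, hp, s, rfl, by simpa using hv.symm⟩

theorem Sound.eval_headStep (hR : Sound φ R) {w v : List (Fin n)} (h : headStep R w = some v) :
    eval φ v = eval φ w := by
  obtain ⟨p, hp, s, rfl, rfl⟩ := headStep_spec h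
  rw [eval_append, eval_append, hR p hp]

theorem Sound.eval_normalize (hR : Sound φ R) (fuel : ℕ) (w : List (Fin n)) :
    eval φ (normalize R fuel w) = eval φ w := by
  induction fuel generalizing w with
  | zero => rfl
  | succ k ih =>
    cases w with
    | nil => rfl
    | cons x w =>
      rw [normalize]
      have hx : eval φ (x :: normalize R k w) = eval φ (x :: w) := by
        rw [eval_cons, eval_cons, ih]
      split
      · exact hx
      · next v hv => rw [ih, hR.eval_headStep hv, hx]

/-- Both reductions keep the value of `w`, whatever `w` is and even if the fuel 50 runs out. The
peaks are thus mere hints that need no justification. -/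
theorem Sound.superpose (hR : Sound φ R) (w : List (Fin n)) : Sound φ (superpose R w) := by
  have hu : eval φ (normalize R 50 ((headStep R w).getD w)) = eval φ (normalize R 50 w) := by
    rw [hR.eval_normalize, hR.eval_normalize]
    cases h : headStep R w with
    | none => rfl
    | some v => exact hR.eval_headStep h
  intro p hp
  simp only [Rewriting.superpose] at hp
  split_ifs at hp <;> rw [List.mem_append, List.mem_singleton] at hp <;> rcases hp with hp | rfl
  exacts [hR p hp, hu.symm, hR p hp, hu]

theorem sound_baseRules {r : Fin n → Fin n → Bool} (h : IsRep (fun i j => r i j = true) φ) :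
    Sound φ (baseRules r) := by
  intro p hp
  simp only [baseRules, List.mem_flatMap, List.mem_finRange, true_and] at hp
  obtain ⟨i, j, hp⟩ := hp
  have hb := h.braid i j
  have ha := h.arrow i j
  have ha' := h.arrow j i
  split_ifs at hp with h1 h2 h3 h3
  · obtain rfl := List.mem_singleton.1 hp
    simpa [eval] using h.idem i
  · obtain rfl := List.mem_singleton.1 hp
    simpa [eval, mul_assoc] using hb
  · have h4 := ha h3
    simp only [List.mem_cons, List.not_mem_nil, or_false] at hp
    rcases hp with rfl | rfl
    · simpa [eval, mul_assoc] using h4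
    · simpa [eval, mul_assoc] using hb.symm.trans h4
  · simp at hp
  · obtain rfl := List.mem_singleton.1 hp
    simpa [eval] using ((ha h3).symm.trans hb).trans (ha' h2)

theorem sound_completion {r : Fin n → Fin n → Bool} (h : IsRep (fun i j => r i j = true) φ)
    (peaks : List (List (Fin n))) : Sound φ (completion r peaks) := by
  suffices ∀ R : Rules n, Sound φ R → Sound φ (peaks.foldl superpose R) from
    -- Braid and commutation rules are listed in both orientations; the filter keeps the decreasing
    -- one.
    this _ fun p hp => sound_baseRules h p (List.mem_of_mem_filter hp)
  induction peaks with
  | nil => exact fun R hR => hR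
  | cons w peaks ih => exact fun R hR => ih _ (hR.superpose w)

theorem weight_append (u v : List (Fin n)) :
    weight (u ++ v) = weight u * (n + 1) ^ v.length + weight v := by
  induction u with
  | nil => simp [weight]
  | cons x u ih =>
    simp only [List.cons_append, weight, List.length_append, ih, pow_add]
    ring

/-- The weight reads a word as a number in base `n + 1` with digits `1, …, n`. Since the length does
not grow, the prefix `a` contributes no more than before. -/
theorem weight_lt_of_decreasing {p : List (Fin n) × List (Fin n)} (hp : decreasing p = true)
    (a s : List (Fin n)) : weight (a ++ (p.2 ++ s)) < weight (a ++ (p.1 ++ s)) := by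
  simp only [decreasing, Bool.and_eq_true, decide_eq_true_eq] at hp
  simp only [weight_append, List.length_append]
  have h1 : (n + 1) ^ (p.2.length + s.length) ≤ (n + 1) ^ (p.1.length + s.length) :=
    Nat.pow_le_pow_right (by omega) (by omega)
  have h2 : weight p.2 * (n + 1) ^ s.length < weight p.1 * (n + 1) ^ s.length :=
    Nat.mul_lt_mul_of_pos_right hp.2 (by positivity)
  have h3 := Nat.mul_le_mul_left (weight a) h1
  omega

theorem mem_irreducibles_or (R : Rules n) (w : List (Fin n)) :
    w ∈ irreducibles R w.length ∨ ∃ a q v, w = a ++ q ∧ headStep R q = some v := by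
  induction w with
  | nil => exact Or.inl (by simp [irreducibles])
  | cons x w ih =>
    rcases ih with ih | ⟨a, q, v, rfl, h⟩
    · cases h : headStep R (x :: w) with
      | none =>
        refine Or.inl ?_
        simp only [List.length_cons, irreducibles, List.mem_flatMap, List.mem_filter, List.mem_map,
          List.mem_finRange, true_and]
        exact ⟨w, ih, ⟨x, rfl⟩, by simp [h]⟩
      | some v => exact Or.inr ⟨[], x :: w, v, rfl, h⟩
    · exact Or.inr ⟨x :: a, q, v, rfl, h⟩

theorem Sound.exists_irreducible (hR : Sound φ R) (hd : R.all decreasing = true)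
    (w : List (Fin n)) : ∃ v ∈ irreducibles R v.length, eval φ v = eval φ w := by
  induction hw : weight w using Nat.strong_induction_on generalizing w with
  | _ k ih =>
    rcases mem_irreducibles_or R w with h | ⟨a, q, v, rfl, h⟩
    · exact ⟨w, h, rfl⟩
    · obtain ⟨p, hp, s, rfl, rfl⟩ := headStep_spec h
      have hlt := weight_lt_of_decreasing (List.all_eq_true.1 hd p hp) a s
      obtain ⟨v, hv, hev⟩ := ih _ (hw ▸ hlt) _ rfl
      refine ⟨v, hv, hev.trans ?_⟩
      simp only [eval_append, hR p hp]

/-- Irreducible words are built by prepending letters to irreducible ones, so one empty length ends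
the enumeration. -/
theorem irreducibles_eq_nil {N k : ℕ} (h : irreducibles R N = []) (hk : N ≤ k) :
    irreducibles R k = [] := by
  induction hk with
  | refl => exact h
  | step _ ih => simp [irreducibles, ih]

theorem exists_eval_of_mem_closure {x : M} (hx : x ∈ Submonoid.closure (Set.range φ)) :
    ∃ w, eval φ w = x := by
  induction hx using Submonoid.closure_induction with
  | mem x hx =>
    obtain ⟨i, rfl⟩ := hx
    exact ⟨[i], by simp [eval]⟩
  | one => exact ⟨[], rfl⟩
  | mul x y _ _ hx hy =>
    obtain ⟨u, rfl⟩ := hx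
    obtain ⟨v, rfl⟩ := hy
    exact ⟨u ++ v, eval_append u v⟩

/-- The relations attached to `r` force finiteness if some completion of them leaves only finitely
many irreducible words. -/
theorem finiteRep_of_completion {r : Fin n → Fin n → Bool} {peaks : List (List (Fin n))} (N : ℕ)
    (h : ((completion r peaks).all decreasing && (irreducibles (completion r peaks) N).isEmpty)
      = true) : FiniteRep fun i j => r i j = true := by
  intro M _ φ hφ
  rw [Bool.and_eq_true, List.isEmpty_iff] at h
  have hfin : (⋃ k ∈ Finset.range N,
      eval φ '' {w | w ∈ irreducibles (completion r peaks) k}).Finite :=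
    Set.Finite.biUnion (Finset.finite_toSet _) fun k _ => (List.finite_toSet _).image _
  refine hfin.subset fun x hx => ?_
  obtain ⟨w, rfl⟩ := exists_eval_of_mem_closure hx
  obtain ⟨v, hv, hvw⟩ := (sound_completion hφ peaks).exists_irreducible h.1 w
  have hlt : v.length < N := by
    by_contra hN
    simp [irreducibles_eq_nil h.2 (not_lt.1 hN)] at hv
  exact Set.mem_biUnion (Finset.mem_coe.2 (Finset.mem_range.2 hlt)) ⟨v, hv, hvw⟩

end Rewriting

/-! ### Operations on relations that preserve finiteness -/

section FiniteRep

universe w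

variable {V W : Type*}

/-- A family for `r` extends by `1` outside the range of `e` to a family for `s`, as a larger
relation imposes fewer equations. -/
theorem FiniteRep.comap {r : V → V → Prop} {s : W → W → Prop} (hs : FiniteRep.{w} s) (e : V → W)
    (he : Function.Injective e) (h : ∀ i j, r i j → s (e i) (e j)) : FiniteRep.{w} r := by
  intro M _ φ hφ
  have hrep : IsRep s (Function.extend e φ 1) := by
    have key : ∀ x, (∃ i, x = e i ∧ Function.extend e φ 1 x = φ i) ∨
        Function.extend e φ 1 x = 1 := by
      intro x
      by_cases hx : ∃ i, e i = x
      · obtain ⟨i, rfl⟩ := hx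
        exact Or.inl ⟨i, rfl, he.extend_apply _ _ _⟩
      · exact Or.inr (Function.extend_apply' _ _ _ hx)
    constructor
    · intro x
      rcases key x with ⟨i, rfl, hi⟩ | hi <;> simp [hi, hφ.idem]
    · intro x y
      rcases key x with ⟨i, rfl, hi⟩ | hi <;> rcases key y with ⟨j, rfl, hj⟩ | hj
      · simpa [hi, hj] using hφ.braid i j
      all_goals simp [hi, hj, hφ.idem]
    · intro x y hxy
      rcases key x with ⟨i, rfl, hi⟩ | hi <;> rcases key y with ⟨j, rfl, hj⟩ | hj
      · simpa [hi, hj] using hφ.arrow i j fun h' => hxy (h _ _ h')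
      all_goals simp [hi, hj, hφ.idem]
  refine (hs M _ hrep).subset (Submonoid.closure_mono ?_)
  rintro _ ⟨i, rfl⟩
  exact ⟨e i, he.extend_apply _ _ _⟩

/-- Passing to the opposite monoid reverses all arrows, so sources can be treated as sinks. -/
theorem FiniteRep.swap {r : V → V → Prop} (h : FiniteRep.{w} (Function.swap r)) :
    FiniteRep.{w} r := by
  intro M _ φ hφ
  have hrep : IsRep (Function.swap r) fun i => MulOpposite.op (φ i) := by
    constructor
    · intro i
      simp [← MulOpposite.op_mul, hφ.idem]
    · intro i j
      simpa [← MulOpposite.op_mul, mul_assoc] using hφ.braid i j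
    · intro i j hij
      simpa [← MulOpposite.op_mul, mul_assoc] using (hφ.braid i j).trans (hφ.arrow j i hij)
  refine ((h _ _ hrep).preimage MulOpposite.op_injective.injOn).subset fun x hx => ?_
  induction hx using Submonoid.closure_induction with
  | mem x hx =>
    obtain ⟨i, rfl⟩ := hx
    exact Submonoid.subset_closure ⟨i, rfl⟩
  | one => exact Submonoid.one_mem _
  | mul x y _ _ hx hy => exact Submonoid.mul_mem _ hy hx

/-- A vertex from which no edge and no arrow emanates may be removed. -/
theorem FiniteRep.of_sink [DecidableEq V] {r : V → V → Prop} (d : V)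
    (hd : ∀ i, i ≠ d → ¬ r d i)
    (h : FiniteRep.{w} fun i j => r i j ∧ i ≠ d ∧ j ≠ d) : FiniteRep.{w} r := by
  intro M _ φ hφ
  set ψ := Function.update φ d 1 with hψ
  have ψd : ψ d = 1 := by simp [hψ]
  have ψi : ∀ i, i ≠ d → ψ i = φ i := fun i hi => by simp [hψ, hi]
  have hrep : IsRep (fun i j => r i j ∧ i ≠ d ∧ j ≠ d) ψ := by
    constructor
    · intro i
      by_cases hi : i = d
      · subst hi; simp [ψd]
      · simp [ψi i hi, hφ.idem]
    · intro i j
      by_cases hi : i = d <;> by_cases hj : j = d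
      · simp [hi, hj]
      · subst hi; simp [ψd, ψi j hj, hφ.idem]
      · subst hj; simp [ψd, ψi i hi, hφ.idem]
      · simpa [ψi i hi, ψi j hj] using hφ.braid i j
    · intro i j hij
      by_cases hi : i = d <;> by_cases hj : j = d
      · simp [hi, hj, ψd]
      · subst hi; simp [ψd]
      · subst hj; simp [ψd, ψi i hi, hφ.idem]
      · simpa [ψi i hi, ψi j hj] using hφ.arrow i j fun h' => hij ⟨h', hj, hi⟩
  set N := Submonoid.closure (Set.range ψ) with hN
  have hfin : (N : Set M).Finite := h M ψ hrep
  -- Only the last occurrence of the sink in a word matters, so every product lies in `N` or in `N *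
  -- φ d * N`.
  have absorb : ∀ v ∈ N, φ d * v * φ d = v * φ d := by
    intro v hv
    induction hv using Submonoid.closure_induction with
    | mem v hv =>
      obtain ⟨i, rfl⟩ := hv
      by_cases hi : i = d
      · subst hi; simp [ψd, hφ.idem]
      · rw [ψi i hi, hφ.braid d i, hφ.arrow i d (hd i hi)]
    | one => simp [hφ.idem]
    | mul x y _ _ hx hy =>
      calc φ d * (x * y) * φ d = φ d * x * (y * φ d) := by simp only [mul_assoc]
        _ = φ d * x * φ d * y * φ d := by rw [← hy]; simp only [mul_assoc]
        _ = x * (φ d * y * φ d) := by rw [hx]; simp only [mul_assoc]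
        _ = x * y * φ d := by rw [hy]; simp only [mul_assoc]
  have hfin' : ((N : Set M) ∪ Set.image2 (fun u v => u * φ d * v) N N).Finite :=
    hfin.union (hfin.image2 _ hfin)
  refine hfin'.subset fun x hx => ?_
  induction hx using Submonoid.closure_induction_right with
  | one => exact Or.inl N.one_mem
  | mul_right x _ y hy hx =>
    obtain ⟨i, rfl⟩ := hy
    by_cases hi : i = d
    · subst hi
      rcases hx with hx | ⟨u, hu, v, hv, rfl⟩
      · exact Or.inr ⟨x, hx, 1, N.one_mem, mul_one _⟩
      · refine Or.inr ⟨u * v, N.mul_mem hu hv, 1, N.one_mem, ?_⟩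
        have := absorb v hv
        simp only [mul_assoc, mul_one] at this ⊢
        rw [this]
    · have hφi : φ i ∈ N := ψi i hi ▸ Submonoid.subset_closure ⟨i, rfl⟩
      rcases hx with hx | ⟨u, hu, v, hv, rfl⟩
      · exact Or.inl (N.mul_mem hx hφi)
      · exact Or.inr ⟨u, hu, v * φ i, N.mul_mem hv hφi, by simp only [mul_assoc]⟩

end FiniteRep

/-! ### Relations on four vertices -/

/-- The relation consisting of the given pairs. -/
def ofPairs (l : List (Fin 4 × Fin 4)) (i j : Fin 4) : Bool := l.contains (i, j)

/-- The path with three edges. -/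
def pathRel : Fin 4 → Fin 4 → Bool := ofPairs [(0, 1), (1, 0), (1, 2), (2, 1), (2, 3), (3, 2)]

/-- The star with three edges. -/
def starRel : Fin 4 → Fin 4 → Bool := ofPairs [(0, 1), (1, 0), (0, 2), (2, 0), (0, 3), (3, 0)]

/-- The digraph `K`. -/
def kRel : Fin 4 → Fin 4 → Bool :=
  ofPairs [(0, 1), (1, 0), (2, 3), (3, 2), (0, 2), (0, 3), (1, 2), (1, 3)]

/-- The digraph `K` without the arrow from `0` to `3`. -/
def kMinusRel : Fin 4 → Fin 4 → Bool :=
  ofPairs [(0, 1), (1, 0), (2, 3), (3, 2), (0, 2), (1, 2), (1, 3)]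

/-- This is the 0-Hecke monoid of type A₄, whose longest element has length 10. -/
theorem finiteRep_pathRel : FiniteRep fun i j => pathRel i j = true :=
  Rewriting.finiteRep_of_completion (peaks := [[2, 1, 2, 0], [3, 2, 3, 1], [3, 2, 1, 3, 0]]) 11
    (by decide +kernel)

/-- This is the 0-Hecke monoid of type D₄, whose longest element has length 12. -/
theorem finiteRep_starRel : FiniteRep fun i j => starRel i j = true :=
  Rewriting.finiteRep_of_completion (peaks := [[2, 0, 2, 1], [2, 1, 0, 1], [3, 0, 3, 1],
    [3, 0, 3, 2], [3, 1, 0, 1], [3, 2, 0, 2], [3, 0, 1, 3, 2], [3, 0, 2, 0, 1, 0],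
    [3, 0, 1, 2, 3, 0, 3]]) 13 (by decide +kernel)

theorem finiteRep_kMinusRel : FiniteRep fun i j => kMinusRel i j = true :=
  Rewriting.finiteRep_of_completion (peaks := [[3, 0, 2, 0], [3, 1, 3, 0], [3, 2, 3, 0],
    [0, 3, 2, 0, 3], [1, 0, 1, 2, 1], [1, 2, 1, 0, 1], [1, 2, 1, 3, 1], [1, 3, 1, 0, 1],
    [1, 3, 1, 2, 1], [2, 0, 2, 1, 2], [2, 1, 2, 0, 2], [3, 1, 3, 2, 3], [3, 2, 3, 1, 3],
    [1, 0, 1, 2, 3, 1], [1, 0, 1, 3, 2, 1], [1, 2, 3, 1, 0, 1], [1, 3, 2, 1, 0, 1],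
    [2, 3, 2, 1, 3, 0], [1, 0, 3, 1, 0, 2, 0], [3, 0, 1, 0, 2, 3, 1], [1, 2, 0, 1, 0, 3, 2, 0],
    [1, 2, 0, 3, 1, 0, 2, 0], [2, 1, 0, 2, 3, 2, 1, 3], [2, 1, 0, 3, 2, 1, 3, 0],
    [0, 2, 0, 3, 1, 0, 2, 3, 1], [1, 3, 1, 2, 0, 1, 3, 2, 0]]) 19 (by decide +kernel)

/-- The four vertices. -/
def verts : List (Fin 4) := [0, 1, 2, 3]

/-- The permutations of the four vertices. -/
def perms : List (Equiv.Perm (Fin 4)) :=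
  verts.flatMap fun x => [1, 2, 3].flatMap fun y => [2, 3].map fun z =>
    Equiv.swap 0 x * Equiv.swap 1 y * Equiv.swap 2 z

/-- The irreflexive relation encoded by the twelve lowest bits of `m`. -/
def relOfBits (m : ℕ) (i j : Fin 4) : Bool :=
  i != j && m.testBit (3 * i + if j < i then j else j - 1)

/-- The off-diagonal part of a relation as a twelve bit number. -/
def encode (r : Fin 4 → Fin 4 → Bool) : ℕ :=
  Nat.ofBits fun k : Fin 12 =>
    r (k.divNat (m := 4) (n := 3))
      ((k.divNat (m := 4) (n := 3)).succAbove (k.modNat (m := 4) (n := 3)))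

/-- The codes of the relations isomorphic to `s`. -/
def codes (s : Fin 4 → Fin 4 → Bool) : List ℕ :=
  perms.map fun σ => encode fun i j => s (σ i) (σ j)

/-- The codes of the basic relations. -/
def basicCodes : List ℕ := codes pathRel ++ codes starRel ++ codes kMinusRel

/-- The codes of the cycles of length three and four. -/
def cycleCodes : List ℕ :=
  codes (ofPairs [(0, 1), (1, 2), (2, 0)]) ++ codes (ofPairs [(0, 1), (1, 2), (2, 3), (3, 0)])

/-- The relation encoded by `m` is contained in a basic one after removing at most `fuel` sinks and
sources. -/
def tame : ℕ → ℕ → Bool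
  | 0, m => basicCodes.any fun t => m &&& t == m
  | fuel + 1, m => tame 0 m || verts.any fun d =>
      (m &&& encode (fun i _ => i == d) == 0 || m &&& encode (fun _ j => j == d) == 0) &&
        tame fuel (m &&& encode fun i j => i != d && j != d)

/-- The entire classification, as a computation on bit masks. Completeness of `perms` is never
needed: a missing permutation could only make the check fail. -/
theorem cycle_or_tame_or_k : ((List.range 4096).all fun m =>
    (cycleCodes.any fun t => m &&& t == t) || tame 2 m || (codes kRel).contains m) = true := by
  decide +kernel

-- Decoding the bit masks

universe u w

theorem relOfBits_encode (r : Fin 4 → Fin 4 → Bool) {i j : Fin 4} (h : i ≠ j) :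
    relOfBits (encode r) i j = r i j := by
  have key : ∀ i j : Fin 4, i ≠ j → ∃ k : Fin 12, (3 * i + if j < i then j else j - 1 : ℕ) = k ∧
      (k.divNat (m := 4) (n := 3)) = i ∧
      ((k.divNat (m := 4) (n := 3)).succAbove (k.modNat (m := 4) (n := 3))) = j := by
    decide
  obtain ⟨k, hk, hi, hj⟩ := key i j h
  simp only [relOfBits, bne_iff_ne.2 h, Bool.true_and, hk, encode,
    Nat.testBit_ofBits_lt _ _ k.isLt, Fin.eta, hi]
  rw [← hi, hj]

theorem relOfBits_self (m : ℕ) (i : Fin 4) : relOfBits m i i = false := by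
  simp [relOfBits]

theorem encode_lt (r : Fin 4 → Fin 4 → Bool) : encode r < 4096 := Nat.ofBits_lt_two_pow _

theorem relOfBits_and (m t : ℕ) (i j : Fin 4) :
    relOfBits (m &&& t) i j = (relOfBits m i j && relOfBits t i j) := by
  simp only [relOfBits, Nat.testBit_and]
  cases i != j <;> simp

theorem exists_perm_of_mem_codes {s : Fin 4 → Fin 4 → Bool} {t : ℕ} (h : t ∈ codes s) :
    ∃ σ : Equiv.Perm (Fin 4), ∀ i j, i ≠ j → relOfBits t i j = s (σ i) (σ j) := by
  obtain ⟨σ, -, rfl⟩ := List.mem_map.1 h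
  exact ⟨σ, fun i j hij => relOfBits_encode _ hij⟩

theorem ne_of_relOfBits {m : ℕ} {i j : Fin 4} (h : relOfBits m i j = true) : i ≠ j := by
  rintro rfl
  simp [relOfBits_self] at h

theorem finiteRep_of_codes {s : Fin 4 → Fin 4 → Bool} (hs : FiniteRep.{w} fun i j => s i j = true)
    {m t : ℕ} (ht : t ∈ codes s) (hm : m &&& t = m) :
    FiniteRep.{w} fun i j => relOfBits m i j = true := by
  obtain ⟨σ, hσ⟩ := exists_perm_of_mem_codes ht
  refine hs.comap σ σ.injective fun i j h => ?_
  rw [← hσ i j (ne_of_relOfBits h)]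
  rw [← hm, relOfBits_and, Bool.and_eq_true] at h
  exact h.2

theorem finiteRep_of_tame_zero {m : ℕ} (h : tame 0 m = true) :
    FiniteRep.{w} fun i j => relOfBits m i j = true := by
  simp only [tame, basicCodes, List.any_eq_true, List.mem_append, beq_iff_eq] at h
  obtain ⟨t, (ht | ht) | ht, hm⟩ := h
  exacts [finiteRep_of_codes finiteRep_pathRel ht hm, finiteRep_of_codes finiteRep_starRel ht hm,
    finiteRep_of_codes finiteRep_kMinusRel ht hm]

theorem finiteRep_of_tame {k m : ℕ} (h : tame k m = true) :
    FiniteRep.{w} fun i j => relOfBits m i j = true := by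
  induction k generalizing m with
  | zero => exact finiteRep_of_tame_zero h
  | succ k ih =>
    rw [tame, Bool.or_eq_true] at h
    rcases h with h | h
    · exact finiteRep_of_tame_zero h
    · simp only [List.any_eq_true, Bool.and_eq_true, Bool.or_eq_true, beq_iff_eq] at h
      obtain ⟨d, -, hd, ht⟩ := h
      have hrem := (ih ht).comap (r := fun i j => relOfBits m i j = true ∧ i ≠ d ∧ j ≠ d) id
        Function.injective_id (by
          rintro i j ⟨h, hi, hj⟩
          simp [relOfBits_and, h, relOfBits_encode _ (ne_of_relOfBits h), hi, hj])
      have hzero : ∀ i j, relOfBits 0 i j = false := by simp [relOfBits]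
      rcases hd with hd | hd
      · refine FiniteRep.of_sink d (fun i hi h => ?_) hrem
        have := hzero d i
        rw [← hd, relOfBits_and, h, relOfBits_encode _ hi.symm] at this
        simp at this
      -- A source is a sink of the reversed relation.
      · refine FiniteRep.swap (FiniteRep.of_sink d (fun i hi h => ?_) ?_)
        · have := hzero i d
          rw [← hd, relOfBits_and, h, relOfBits_encode _ hi] at this
          simp at this
        · exact FiniteRep.swap (hrem.comap id Function.injective_id
            fun i j ⟨h, hi, hj⟩ => ⟨h, hj, hi⟩)

/-- A relation on four vertices has a cycle, or it forces finiteness, or it is isomorphic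
to `kRel`. -/
theorem exists_cycle_or_finiteRep_or_kRel (r : Fin 4 → Fin 4 → Bool) (hr : ∀ i, r i i = false) :
    (∃ f : Fin 3 → Fin 4, Function.Injective f ∧ ∀ i, r (f i) (f (i + 1)) = true) ∨
    (∃ f : Fin 4 → Fin 4, Function.Injective f ∧ ∀ i, r (f i) (f (i + 1)) = true) ∨
    FiniteRep.{w} (fun i j => r i j = true) ∨
    ∃ σ : Equiv.Perm (Fin 4), ∀ i j, r i j = kRel (σ i) (σ j) := by
  have h := List.all_eq_true.1 cycle_or_tame_or_k (encode r) (List.mem_range.2 (encode_lt r))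
  simp only [Bool.or_eq_true, List.any_eq_true, beq_iff_eq, cycleCodes, List.mem_append,
    List.contains_iff_mem] at h
  have hcycle : ∀ (s : Fin 4 → Fin 4 → Bool) (t : ℕ), t ∈ codes s → encode r &&& t = t →
      ∃ σ : Equiv.Perm (Fin 4), ∀ i j, i ≠ j → s i j = true → r (σ i) (σ j) = true := by
    intro s t ht hrt
    obtain ⟨σ, hσ⟩ := exists_perm_of_mem_codes ht
    refine ⟨σ.symm, fun i j hij hs => ?_⟩
    have hne : σ.symm i ≠ σ.symm j := σ.symm.injective.ne hij
    have h1 : relOfBits t (σ.symm i) (σ.symm j) = true := by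
      rw [hσ _ _ hne, σ.apply_symm_apply, σ.apply_symm_apply, hs]
    rw [← hrt, relOfBits_and, Bool.and_eq_true, relOfBits_encode _ hne] at h1
    exact h1.1
  rcases h with (⟨t, ht | ht, hrt⟩ | h) | h
  · obtain ⟨σ, hσ⟩ := hcycle _ t ht hrt
    refine Or.inl ⟨fun i => σ (Fin.castSucc i),
      σ.injective.comp (Fin.castSucc_injective 3), fun i => hσ _ _ ?_ ?_⟩ <;>
      revert i <;> decide
  · obtain ⟨σ, hσ⟩ := hcycle _ t ht hrt
    refine Or.inr (Or.inl ⟨σ, σ.injective, fun i => hσ _ _ ?_ ?_⟩) <;> revert i <;> decide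
  · refine Or.inr (Or.inr (Or.inl ?_))
    refine (finiteRep_of_tame h).comap id Function.injective_id fun i j hij => ?_
    rw [id, id, relOfBits_encode, hij]
    rintro rfl
    simp [hr] at hij
  · obtain ⟨σ, hσ⟩ := exists_perm_of_mem_codes h
    refine Or.inr (Or.inr (Or.inr ⟨σ, fun i j => ?_⟩))
    by_cases hij : i = j
    · subst hij
      rw [hr]
      generalize σ i = k
      revert k
      decide
    · rw [← hσ i j hij, relOfBits_encode _ hij]

/-! ### The relation attached to a digraph -/

section Step

variable {V W : Type*}

/-- There is an edge or an arrow from `i` to `j`. -/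
def Step (Q : MixedDigraph V) (i j : V) : Prop := Q.edge.Adj i j ∨ Q.arrow i j

theorem edge_iff_step (Q : MixedDigraph V) (i j : V) :
    Q.edge.Adj i j ↔ Q.Step i j ∧ Q.Step j i := by
  have h1 := Q.arrow_asymm i j
  have h2 := Q.edge.adj_comm i j
  unfold Step
  tauto

theorem arrow_iff_step (Q : MixedDigraph V) (i j : V) :
    Q.arrow i j ↔ Q.Step i j ∧ ¬ Q.Step j i := by
  have h1 := Q.arrow_asymm i j
  have h2 := Q.edge.adj_comm i j
  have h3 := Q.not_edge_of_arrow i j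
  unfold Step
  tauto

theorem not_step_self (Q : MixedDigraph V) (i : V) : ¬ Q.Step i i := by
  have h1 := Q.arrow_asymm i i
  have h2 := Q.edge.irrefl (v := i)
  unfold Step
  tauto

/-- The symmetric part of `Step` gives the edges and the rest the arrows, so `Step` determines the
digraph. -/
theorem isomorphic_iff_step (Q : MixedDigraph V) (R : MixedDigraph W) :
    Q.Isomorphic R ↔ ∃ e : V ≃ W, ∀ i j, R.Step (e i) (e j) ↔ Q.Step i j := by
  constructor
  · rintro ⟨e, h1, h2⟩
    exact ⟨e, fun i j => or_congr (h1 i j) (h2 i j)⟩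
  · rintro ⟨e, h⟩
    exact ⟨e, fun i j => by simp only [edge_iff_step, h],
      fun i j => by simp only [arrow_iff_step, h]⟩

theorem isRep_of (Q : MixedDigraph V) : IsRep Q.Step (PresentedMonoid.of Q.HKRel) := by
  have sound : ∀ {a b}, Q.HKRel a b → PresentedMonoid.mk Q.HKRel a = PresentedMonoid.mk Q.HKRel b :=
    fun h => (Con.eq _).2 (ConGen.Rel.of _ _ h)
  have idem : ∀ i, PresentedMonoid.of Q.HKRel i * PresentedMonoid.of Q.HKRel i =
      PresentedMonoid.of Q.HKRel i := fun i => sound (.idem i)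
  have arr : ∀ i j, Q.arrow i j → _ ∧ _ := fun i j h =>
    And.intro (sound (.arrow_left i j h)) (sound (.arrow_right i j h))
  have comm : ∀ i j, ¬ Q.Connected i j → _ := fun i j h => sound (.comm i j h)
  simp only [map_mul] at arr comm
  refine ⟨idem, fun i j => ?_, fun i j h => ?_⟩
  · by_cases h1 : Q.edge.Adj i j
    · exact sound (.braid i j h1)
    by_cases h2 : Q.arrow i j
    · exact (arr i j h2).1.symm.trans (arr i j h2).2
    by_cases h3 : Q.arrow j i
    · exact (arr j i h3).2.symm.trans (arr j i h3).1
    have h4 := comm i j (by simp [Connected, h1, h2, h3])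
    change PresentedMonoid.of Q.HKRel i * PresentedMonoid.of Q.HKRel j =
      PresentedMonoid.of Q.HKRel j * PresentedMonoid.of Q.HKRel i at h4
    rw [h4, mul_assoc, idem, ← h4, mul_assoc, idem, h4]
  · have h1 : ¬ Q.edge.Adj i j := fun h' => h (Or.inl h'.symm)
    by_cases h2 : Q.arrow i j
    · exact (arr i j h2).1.symm
    have h4 := comm i j (by
      have : ¬ Q.arrow j i := fun h' => h (Or.inr h')
      simp [Connected, h1, h2, this])
    change PresentedMonoid.of Q.HKRel i * PresentedMonoid.of Q.HKRel j =
      PresentedMonoid.of Q.HKRel j * PresentedMonoid.of Q.HKRel i at h4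
    rw [h4, mul_assoc, idem]

theorem FiniteRep.finiteType {V : Type u} {Q : MixedDigraph V} (h : FiniteRep.{u} Q.Step) :
    Q.FiniteType := by
  have := h _ _ Q.isRep_of
  rw [PresentedMonoid.closure_range_of] at this
  exact Set.finite_univ_iff.1 this

/-- Every family factors through `H_Q`. The target universe is arbitrary, so actions in universe `0`
suffice to refute finiteness. -/
theorem FiniteType.finiteRep {Q : MixedDigraph V} (h : Q.FiniteType) : FiniteRep.{w} Q.Step := by
  intro M _ φ hφ
  have hrel : ∀ a b, Q.HKRel a b → FreeMonoid.lift φ a = FreeMonoid.lift φ b := by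
    intro a b hab
    induction hab with
    | idem i => simpa using hφ.idem i
    | comm i j hij =>
      simp only [Connected, not_or] at hij
      have h1 := hφ.arrow i j (by
        have := Q.edge.adj_comm i j
        unfold Step
        tauto)
      have h2 := hφ.arrow j i (by unfold Step; tauto)
      -- Commutation is `ij = iji = jij = ji`.
      simpa using h1.symm.trans ((hφ.braid i j).trans h2)
    | braid i j => simpa using hφ.braid i j
    | arrow_left i j hij => simpa using (hφ.arrow i j ((Q.arrow_iff_step i j).1 hij).2).symm
    | arrow_right i j hij =>
      simpa using ((hφ.arrow i j ((Q.arrow_iff_step i j).1 hij).2).symm.trans (hφ.braid i j))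
  have : Finite Q.HeckeKiselman := h
  refine (Set.finite_range (PresentedMonoid.lift φ hrel)).subset ?_
  rw [← MonoidHom.coe_mrange, SetLike.coe_subset_coe, Submonoid.closure_le]
  rintro _ ⟨i, rfl⟩
  exact ⟨PresentedMonoid.of _ i, PresentedMonoid.lift_of ..⟩

theorem K_step (i j : Fin 4) : K.Step i j ↔ kRel i j = true := by
  simp only [Step, K, SimpleGraph.fromEdgeSet_adj, Set.mem_insert_iff, Set.mem_singleton_iff]
  revert i j
  decide

theorem K_acyclic : K.Acyclic := by
  have three : ∀ c : Fin 3 → Fin 4, Function.Injective c →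
      ¬ ∀ i, kRel (c i) (c (i + 1)) = true := by decide +kernel
  have four : ∀ c : Fin 4 → Fin 4, Function.Injective c →
      ¬ ∀ i, kRel (c i) (c (i + 1)) = true := by decide +kernel
  rintro n c ⟨hn, hc, h⟩
  have : NeZero n := ⟨by omega⟩
  have hle : n ≤ 4 := by simpa [ZMod.card] using Fintype.card_le_of_injective c hc
  have h' : ∀ i, kRel (c i) (c (i + 1)) = true := fun i => (K_step _ _).1 (h i)
  obtain rfl | rfl : n = 3 ∨ n = 4 := by omega
  · exact three c hc h'
  · exact four c hc h'

/-! ### Infinite types -/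

theorem isRep_of_forall_ne {r : V → V → Prop} {M : Type*} [Monoid M] {φ : V → M}
    (h₁ : ∀ i, φ i * φ i = φ i)
    (h₂ : ∀ i j, i ≠ j → ¬ r j i → φ i * φ j * φ i = φ i * φ j ∧ φ j * φ i * φ j = φ i * φ j)
    (h₃ : ∀ i j, r i j → r j i → φ i * φ j * φ i = φ j * φ i * φ j) : IsRep r φ := by
  refine ⟨h₁, fun i j => ?_, fun i j h => ?_⟩
  · by_cases hij : i = j
    · rw [hij]
    by_cases hr : r j i
    · by_cases hr' : r i j
      · exact h₃ i j hr' hr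
      · exact (h₂ j i (Ne.symm hij) hr').2.trans (h₂ j i (Ne.symm hij) hr').1.symm
    · exact (h₂ i j hij hr).1.trans (h₂ i j hij hr).2.symm
  · by_cases hij : i = j
    · rw [hij, h₁, h₁]
    · exact (h₂ i j hij h).1

/-- Replace the `i`-th coordinate by the successor of the next one. -/
def cycleUpdate (n : ℕ) (i : ZMod n) : Function.End (ZMod n → ℕ) :=
  fun x => Function.update x i (x (i + 1) + 1)

theorem isRep_cycleUpdate {n : ℕ} (hn : 3 ≤ n) :
    IsRep (fun i j : ZMod n => j = i + 1) (cycleUpdate n) := by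
  have : Fact (1 < n) := ⟨by omega⟩
  -- For `n ≥ 3` no two vertices step to each other, so the third condition of `isRep_of_forall_ne`
  -- is vacuous.
  have h2 : (2 : ZMod n) ≠ 0 := by
    intro h
    have := (ZMod.natCast_eq_zero_iff 2 n).1 (by exact_mod_cast h)
    exact absurd (Nat.le_of_dvd (by norm_num) this) (by omega)
  have hne : ∀ i : ZMod n, i + 1 ≠ i := fun i => by simp
  refine isRep_of_forall_ne (fun i => ?_) (fun i j hij hr => ⟨?_, ?_⟩) (fun i j h h' => ?_)
  · funext x
    change cycleUpdate n i (cycleUpdate n i x) = cycleUpdate n i x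
    simp [cycleUpdate]
  · funext x
    change cycleUpdate n i (cycleUpdate n j (cycleUpdate n i x)) =
      cycleUpdate n i (cycleUpdate n j x)
    funext k
    simp only [cycleUpdate, Function.update_apply, hne, Ne.symm hr, if_false]
    split_ifs <;> rfl
  · funext x
    change cycleUpdate n j (cycleUpdate n i (cycleUpdate n j x)) =
      cycleUpdate n i (cycleUpdate n j x)
    funext k
    simp only [cycleUpdate, Function.update_apply, hne, Ne.symm hr, if_false]
    by_cases hk : k = j
    · simp [hk, hij.symm]
    · simp [hk]
  · exact absurd (show (2 : ZMod n) = 0 by linear_combination -h - h') h2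

theorem not_finiteRep_cycle {n : ℕ} (hn : 3 ≤ n) :
    ¬ FiniteRep.{0} fun i j : ZMod n => j = i + 1 := by
  intro h
  have : NeZero n := ⟨by omega⟩
  have hfin := h _ _ (isRep_cycleUpdate hn)
  set C := Submonoid.closure (Set.range (cycleUpdate n))
  -- Updating each coordinate once, in any order, raises the lower bound of the image of the zero
  -- vector by one.
  have step : ∀ m : ℕ, ∀ f ∈ C, (∀ k, m ≤ f 0 k) → ∀ s : Finset (ZMod n),
      ∃ g ∈ C, (∀ k, m ≤ g 0 k) ∧ ∀ k ∈ s, m + 1 ≤ g 0 k := by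
    intro m f hf hm s
    induction s using Finset.induction_on with
    | empty => exact ⟨f, hf, hm, by simp⟩
    | insert i s _ ih =>
      obtain ⟨g, hg, h1, h2⟩ := ih
      have hi : ∀ k, (cycleUpdate n i * g) 0 k = if k = i then g 0 (i + 1) + 1 else g 0 k := by
        intro k
        exact Function.update_apply ..
      refine ⟨cycleUpdate n i * g, C.mul_mem (Submonoid.subset_closure ⟨i, rfl⟩) hg,
        fun k => ?_, fun k hk => ?_⟩
      · rw [hi]
        have := h1 k
        have := h1 (i + 1)
        split_ifs <;> omega
      · rw [hi]
        have := h1 (i + 1)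
        split_ifs with hki
        · omega
        · exact h2 k (Finset.mem_of_mem_insert_of_ne hk hki)
  have unbounded : ∀ m : ℕ, ∃ f ∈ C, ∀ k, m ≤ f 0 k := by
    intro m
    induction m with
    | zero => exact ⟨1, C.one_mem, fun k => Nat.zero_le _⟩
    | succ m ih =>
      obtain ⟨f, hf, hm⟩ := ih
      obtain ⟨g, hg, -, h2⟩ := step m f hf hm Finset.univ
      exact ⟨g, hg, fun k => h2 k (Finset.mem_univ k)⟩
  obtain ⟨b, hb⟩ := (hfin.image fun f => f 0 0).bddAbove
  obtain ⟨f, hf, hm⟩ := unbounded (b + 1)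
  have h1 : f 0 0 ≤ b := hb ⟨f, hf, rfl⟩
  have h2 := hm 0
  omega

theorem FiniteType.acyclic {Q : MixedDigraph V} (h : Q.FiniteType) : Q.Acyclic := by
  rintro n c ⟨hn, hc, hstep⟩
  refine not_finiteRep_cycle hn (h.finiteRep.comap c hc ?_)
  rintro i _ rfl
  exact hstep i

/-- The transitions between the seven states of an automaton with input letters `0`, `1`, `2`, `3`.
-/
def kNext : Fin 4 → Fin 7 → Fin 7 :=
  ![![2, 3, 2, 3, 6, 6, 6], ![0, 6, 6, 5, 0, 5, 6], ![1, 1, 1, 3, 6, 5, 6], ![0, 6, 2, 4, 4, 4, 6]]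

/-- The action of the vertices of `K` on the states together with a counter. The state `6` is
absorbing and resets the counter, which increases when `1` leads from the state `4` to the state `0`.
-/
def kAction (i : Fin 4) : Function.End (ℕ × Fin 7) := fun x =>
  (if kNext i x.2 = 6 then 0 else if i = 1 ∧ x.2 = 4 then x.1 + 1 else x.1, kNext i x.2)

theorem isRep_kAction : IsRep (fun i j => kRel i j = true) kAction := by
  refine ⟨fun i => ?_, fun i j => ?_, fun i j h => ?_⟩ <;> funext ⟨n, x⟩
  · change kAction i (kAction i (n, x)) = kAction i (n, x)
    fin_cases i <;> fin_cases x <;> simp [kAction, kNext]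
  · change kAction i (kAction j (kAction i (n, x))) = kAction j (kAction i (kAction j (n, x)))
    fin_cases i <;> fin_cases j <;> fin_cases x <;> simp [kAction, kNext]
  · change kAction i (kAction j (kAction i (n, x))) = kAction i (kAction j (n, x))
    revert h
    fin_cases i <;> fin_cases j <;> fin_cases x <;> simp [kAction, kNext, kRel, ofPairs]

theorem not_finiteRep_kRel : ¬ FiniteRep.{0} fun i j => kRel i j = true := by
  intro h
  have hfin := h _ _ isRep_kAction
  set C := Submonoid.closure (Set.range kAction)
  have hmem : ∀ i, kAction i ∈ C := fun i => Submonoid.subset_closure ⟨i, rfl⟩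
  have unbounded : ∀ m : ℕ, ∃ f ∈ C, f (0, 0) = (m, 0) := by
    intro m
    induction m with
    | zero => exact ⟨1, C.one_mem, rfl⟩
    | succ m ih =>
      obtain ⟨f, hf, hm⟩ := ih
      -- The letters 2, 0, 3, 1, applied in this order, run through the states 0, 1, 3, 4, 0 and
      -- raise the counter once.
      refine ⟨kAction 1 * kAction 3 * kAction 0 * kAction 2 * f,
        C.mul_mem (C.mul_mem (C.mul_mem (C.mul_mem (hmem 1) (hmem 3)) (hmem 0)) (hmem 2)) hf, ?_⟩
      change kAction 1 (kAction 3 (kAction 0 (kAction 2 (f (0, 0))))) = _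
      rw [hm]
      rfl
  obtain ⟨b, hb⟩ := (hfin.image fun f => (f (0, 0)).1).bddAbove
  obtain ⟨f, hf, hm⟩ := unbounded (b + 1)
  have := hb ⟨f, hf, rfl⟩
  simp [hm] at this

theorem K_not_finiteType : ¬ K.FiniteType := fun h =>
  not_finiteRep_kRel (h.finiteRep.comap id Function.injective_id fun i j => (K_step i j).2)

theorem FiniteType.not_isomorphic_K {Q : MixedDigraph V} (h : Q.FiniteType) :
    ¬ Q.Isomorphic K := by
  rw [isomorphic_iff_step]
  rintro ⟨e, he⟩
  refine K_not_finiteType (FiniteRep.finiteType (h.finiteRep.comap e.symm e.symm.injective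
    fun i j hij => ?_))
  rw [← he]
  simpa using hij

/-! ### Acyclic digraphs with at most four vertices -/

/-- Smaller digraphs are padded with isolated vertices, so that the classification on `Fin 4`
applies to all of them. -/
theorem Acyclic.finiteType_or_isomorphic_K [Finite V] {Q : MixedDigraph V} (hQ : Q.Acyclic)
    (hV : Nat.card V ≤ 4) : Q.FiniteType ∨ Q.Isomorphic K := by
  classical
  have := Fintype.ofFinite V
  obtain ⟨e⟩ : Nonempty (V ↪ Fin 4) :=
    Function.Embedding.nonempty_of_card_le (by simpa [Nat.card_eq_fintype_card] using hV)
  set r : Fin 4 → Fin 4 → Bool := fun i j => decide (∃ x y, e x = i ∧ e y = j ∧ Q.Step x y) with hr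
  have hre : ∀ x y, r (e x) (e y) = true ↔ Q.Step x y := by
    intro x y
    simp [hr]
  have hrange : ∀ i j, r i j = true → (∃ x, e x = i) ∧ ∃ y, e y = j := by
    intro i j h
    obtain ⟨x, y, hx, hy, -⟩ := of_decide_eq_true h
    exact ⟨⟨x, hx⟩, y, hy⟩
  have hirr : ∀ i, r i i = false := by
    intro i
    by_contra h
    rw [Bool.not_eq_false] at h
    obtain ⟨x, rfl⟩ := (hrange i i h).1
    exact Q.not_step_self x ((hre x x).1 h)
  have hcycle : ∀ k, 2 ≤ k → ∀ f : Fin (k + 1) → Fin 4, Function.Injective f →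
      ¬ ∀ i, r (f i) (f (i + 1)) = true := by
    intro k hk f hf h
    choose g hg using fun i => (hrange _ _ (h i)).1
    -- `ZMod (k + 1)` is `Fin (k + 1)` by definition.
    refine hQ (k + 1) (show Fin (k + 1) → V from g) ⟨by omega, fun i j hij => hf ?_,
      fun (i : Fin (k + 1)) => ?_⟩
    · rw [← hg i, ← hg j, hij]
    · refine (hre (g i) (g (i + 1))).1 ?_
      have := h i
      rwa [← hg i, ← hg (i + 1)] at this
  rcases exists_cycle_or_finiteRep_or_kRel r hirr with ⟨f, hf, h⟩ | ⟨f, hf, h⟩ | h | ⟨σ, hσ⟩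
  · exact absurd h (hcycle 2 le_rfl f hf)
  · exact absurd h (hcycle 3 (by norm_num) f hf)
  · exact Or.inl (h.comap e e.injective fun x y hxy => (hre x y).2 hxy).finiteType
  · refine Or.inr ((isomorphic_iff_step _ _).2 ?_)
    -- `K` has no isolated vertex, so no padding took place.
    have hsurj : Function.Surjective e := by
      intro i
      have hk : ∀ k, ∃ l, kRel k l = true ∨ kRel l k = true := by decide
      obtain ⟨l, hl⟩ := hk (σ i)
      obtain ⟨l, rfl⟩ := σ.surjective l
      rw [← hσ, ← hσ] at hl
      rcases hl with hl | hl
      exacts [(hrange _ _ hl).1, (hrange _ _ hl).2]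
    refine ⟨(Equiv.ofBijective e ⟨e.injective, hsurj⟩).trans σ, fun x y => ?_⟩
    rw [K_step, ← hre, hσ]
    rfl

end Step

end MixedDigraph

theorem mainTheorem1 :
    (MixedDigraph.K.Acyclic ∧ ¬ MixedDigraph.K.FiniteType) ∧
    (∀ {V : Type*} [Finite V] (Q : MixedDigraph V), Nat.card V = 4 → Q.Acyclic →
      ¬ Q.FiniteType → Q.Isomorphic MixedDigraph.K) ∧
    (∀ {V : Type*} [Finite V] (Q : MixedDigraph V), Nat.card V ≤ 4 →
      (Q.FiniteType ↔ Q.Acyclic ∧ ¬ Q.Isomorphic MixedDigraph.K)) := by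
  refine ⟨⟨MixedDigraph.K_acyclic, MixedDigraph.K_not_finiteType⟩, ?_, ?_⟩
  · intro V _ Q hV hQ hinf
    exact (hQ.finiteType_or_isomorphic_K hV.le).resolve_left hinf
  · intro V _ Q hV
    exact ⟨fun h => ⟨h.acyclic, h.not_isomorphic_K⟩,
      fun h => (h.1.finiteType_or_isomorphic_K hV).resolve_right h.2⟩
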